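/- Let $n\ge 1$, $f\in C^1(\mathbb{R})$, $G\in C^2(\mathbb{R}^n)$, and let $a\in C^{1,1}_{loc}((0,+\infty))$ satisfy $a(t)>0$ and $a(t)+a'(t)t>0$ for every $t>0$. Put $d\mu=e^{G(x)}\,dx$ and, for $\xi\in\mathbb{R}^n$, \[ A_{hk}(\xi)=\frac{a'(|\xi|)}{|\xi|}\,\xi_h\xi_k+a(|\xi|)\,\delta_{hk}\qquad(1\le h,k\le n), \] with $A_{hk}(0)=a(0)\delta_{hk}$. A weak solution of \[ \mathrm{div}(a(|\nabla u|)\nabla u)+a(|\nabla u|)\langle\nabla G,\nabla u\rangle+f(u)=0\quad\text{in }\mathbb{R}^n \] is a function $u\in C^1(\mathbb{R}^n)$ such that \[ \int_{\mathbb{R}^n}\langle a(|\nabla u|)\nabla u,\nabla\varphi\rangle-f(u)\varphi\;d\mu=0\qquad\text{for all }\varphi\in C^1_c(\mathbb{R}^n), \] and such that either $\{\nabla u=0\}=\emptyset$, or $a\in C^0([0,+\infty))$ and the map $t\mapsto ta(t)$ belongs to $C^1([0,+\infty))$. For $h\in L^1_{loc}(\mathbb{R}^n)$, a weak solution $u$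 is called $h$-stable if \[ \int_{\mathbb{R}^n}\langle A(\nabla u)\nabla\varphi,\nabla\varphi\rangle-f'(u)\varphi^2\;d\mu\;\ge\;\int_{\mathbb{R}^n}a(|\nabla u|)\,h\,\varphi^2\;d\mu\qquad\text{for all }\varphi\in C^1_c(\mathbb{R}^n). \] Let $u$ be a weak solution and suppose that there is $i\in\{1,\dots,n\}$ with $u_i(x):=\partial_i u(x)>0$ for every $x\in\mathbb{R}^n$. Then, writing $G_i:=\partial_i G$, the function \[ h(x):=\frac{\langle\nabla u(x),\nabla G_i(x)\rangle}{u_i(x)} \] belongs to $L^1_{loc}(\mathbb{R}^n)$ and $u$ is $h$-stable. -/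

import Mathlib

open MeasureTheory Set

/-- The partial derivative `∂ᵢ g` of `g : ℝⁿ → ℝ`. -/
noncomputable def partialDeriv {n : ℕ} (i : Fin n) (g : EuclideanSpace ℝ (Fin n) → ℝ)
    (x : EuclideanSpace ℝ (Fin n)) : ℝ :=
  fderiv ℝ g x (EuclideanSpace.single i 1)

/-- `a ∈ C^{1,1}_loc((0,+∞))`. -/
def IsC11LocPos (a : ℝ → ℝ) : Prop :=
  ContDiffOn ℝ 1 a (Ioi 0) ∧ LocallyLipschitzOn (Ioi 0) (deriv a)

/-- The measure `dμ = e^{G(x)} dx` on `ℝⁿ`. -/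
noncomputable def weightedMeasure {n : ℕ} (G : EuclideanSpace ℝ (Fin n) → ℝ) :
    Measure (EuclideanSpace ℝ (Fin n)) :=
  volume.withDensity fun x => ENNReal.ofReal (Real.exp (G x))

/-- The matrix `A_{hk}(ξ) = (a'(|ξ|) / |ξ|) ξ_h ξ_k + a(|ξ|) δ_{hk}`.
For `ξ = 0` the first summand is `0`, so that `A_{hk}(0) = a(0) δ_{hk}`. -/
noncomputable def coeffMatrix {n : ℕ} (a : ℝ → ℝ) (ξ : EuclideanSpace ℝ (Fin n)) :
    Matrix (Fin n) (Fin n) ℝ :=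
  Matrix.of fun h k =>
    deriv a ‖ξ‖ / ‖ξ‖ * ξ h * ξ k + a ‖ξ‖ * (1 : Matrix (Fin n) (Fin n) ℝ) h k

/-- `u` is a weak solution of `div(a(|∇u|)∇u) + a(|∇u|)⟨∇G, ∇u⟩ + f(u) = 0` in `ℝⁿ`.
By the last clause, the integrand is continuous with compact support when `f` is continuous and
`a` is continuous on `(0,+∞)`. -/
structure IsWeakSolution {n : ℕ} (a f : ℝ → ℝ) (G u : EuclideanSpace ℝ (Fin n) → ℝ) :
    Prop where
  contDiff : ContDiff ℝ 1 u
  weak_eq : ∀ φ : EuclideanSpace ℝ (Fin n) → ℝ, ContDiff ℝ 1 φ → HasCompactSupport φ →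
    ∫ x, (inner ℝ (a ‖gradient u x‖ • gradient u x) (gradient φ x) - f (u x) * φ x)
      ∂(weightedMeasure G) = 0
  /-- Either `u` has no critical point, or `a ∈ C⁰([0,+∞))` and `t ↦ t a(t)` is in
  `C¹([0,+∞))`. -/
  nondegenerate : {x | gradient u x = 0} = ∅ ∨
    (ContinuousOn a (Ici 0) ∧ ContDiffOn ℝ 1 (fun t => t * a t) (Ici 0))

/-- `u` is an `h`-stable weak solution, where `h ∈ L¹_loc(ℝⁿ)`. Under the standing assumptions
on `a`, `f` and `G`, the two integrands are integrable with respect to `μ`. -/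
structure IsHStable {n : ℕ} (a f : ℝ → ℝ) (G h u : EuclideanSpace ℝ (Fin n) → ℝ) :
    Prop where
  locallyIntegrable : LocallyIntegrable h volume
  isWeakSolution : IsWeakSolution a f G u
  stable : ∀ φ : EuclideanSpace ℝ (Fin n) → ℝ, ContDiff ℝ 1 φ → HasCompactSupport φ →
    ∫ x, a ‖gradient u x‖ * h x * φ x ^ 2 ∂(weightedMeasure G) ≤
      ∫ x, (inner ℝ (Matrix.toEuclideanLin (coeffMatrix a (gradient u x)) (gradient φ x))
          (gradient φ x) - deriv f (u x) * φ x ^ 2) ∂(weightedMeasure G)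

/-! Formally, `∂ᵢu` solves the linearized equation; testing it with `φ² / ∂ᵢu` and applying Picone's
inequality gives stability, `h` coming from differentiating the drift `∇G`. But `u` is only `C¹`, so
the argument is run on difference quotients. With `e` the `i`-th basis vector, `wₜ = (u(x + te) -
u(x)) / t` is `C¹` and positive for `t > 0`, so `φ² / wₜ` is an admissible test function for the
difference of the translated and original equations (`integral_diffQuot`). The flux increment is the
flux derivative at some point of the segment joining the two gradients (`exists_inner_flux_sub_le`);
that segment avoids `0`, since both gradients have positive `e`-component. Picone holds at that
point, and all other terms converge locally uniformly as `t → 0⁺`. So the tested integrand, whose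
integral is `0`, is at most the stability integrand plus `ε` on the support of `φ`
(`eventually_diffQuot_integrand_le`). -/

open Filter Topology

/-! ### Ellipticity and the Picone inequality for the flux -/

section Flux

variable {F : Type*} [NormedAddCommGroup F] [InnerProductSpace ℝ F]

/-- The bilinear form of the derivative of the flux `ξ ↦ a(|ξ|) ξ` at `ξ`. -/
noncomputable def fluxForm (a : ℝ → ℝ) (ξ η ζ : F) : ℝ :=
  deriv a ‖ξ‖ / ‖ξ‖ * inner ℝ ξ η * inner ℝ ξ ζ + a ‖ξ‖ * inner ℝ η ζ

/-- The form has eigenvalue `a + a'|ξ|` along `ξ` and `a` orthogonally to it. If `a' ≥ 0` both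
summands are nonnegative; if `a' ≤ 0`, Cauchy–Schwarz bounds the form below by `(a + a'|ξ|)|η|²`. -/
theorem fluxForm_self_nonneg {a : ℝ → ℝ} (ha_pos : ∀ t : ℝ, 0 < t → 0 < a t)
    (ha_ell : ∀ t : ℝ, 0 < t → 0 < a t + deriv a t * t) {ξ : F} (hξ : ξ ≠ 0) (η : F) :
    0 ≤ fluxForm a ξ η η := by
  have hr : 0 < ‖ξ‖ := norm_pos_iff.2 hξ
  have hcs : inner ℝ ξ η * inner ℝ ξ η ≤ ‖ξ‖ ^ 2 * ‖η‖ ^ 2 := by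
    have := real_inner_mul_inner_self_le ξ η
    rwa [real_inner_self_eq_norm_sq, real_inner_self_eq_norm_sq] at this
  have h1 := ha_pos _ hr
  have h2 := ha_ell _ hr
  unfold fluxForm
  rw [real_inner_self_eq_norm_sq, mul_assoc]
  rcases le_total 0 (deriv a ‖ξ‖) with h | h
  · have := mul_self_nonneg (inner ℝ ξ η)
    positivity
  · have h3 : deriv a ‖ξ‖ / ‖ξ‖ ≤ 0 := div_nonpos_of_nonpos_of_nonneg h hr.le
    have h4 := mul_le_mul_of_nonpos_left hcs h3
    have h5 : deriv a ‖ξ‖ / ‖ξ‖ * (‖ξ‖ ^ 2 * ‖η‖ ^ 2) = deriv a ‖ξ‖ * ‖ξ‖ * ‖η‖ ^ 2 := by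
      field_simp
    have h6 := mul_nonneg h2.le (sq_nonneg ‖η‖)
    linarith

/-- The pointwise Picone-type inequality for the quadratic form of the flux. -/
theorem fluxForm_picone {a : ℝ → ℝ} (ha_pos : ∀ t : ℝ, 0 < t → 0 < a t)
    (ha_ell : ∀ t : ℝ, 0 < t → 0 < a t + deriv a t * t) {ξ : F} (hξ : ξ ≠ 0) (z q : F) (r : ℝ) :
    fluxForm a ξ z ((2 * r) • q - r ^ 2 • z) ≤ fluxForm a ξ q q := by
  -- Expanding the form at `q - r z` and using its symmetry is exactly the claim.
  have h := fluxForm_self_nonneg ha_pos ha_ell hξ (q - r • z)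
  have hs := real_inner_comm q z
  simp only [fluxForm, inner_sub_left, inner_sub_right, inner_smul_left, inner_smul_right,
    RCLike.conj_to_real] at h ⊢
  rw [hs] at *
  linear_combination h

theorem hasDerivAt_inner_flux_segment {a : ℝ → ℝ} {ξ η : F} {s : ℝ} (h0 : ξ + s • η ≠ 0)
    (ha : DifferentiableAt ℝ a ‖ξ + s • η‖) (c : F) :
    HasDerivAt (fun s : ℝ => inner ℝ (a ‖ξ + s • η‖ • (ξ + s • η)) c)
      (fluxForm a (ξ + s • η) η c) s := by
  have hl : HasDerivAt (fun s : ℝ => ξ + s • η) η s := by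
    simpa using ((hasDerivAt_id s).smul_const η).const_add ξ
  have hsq : HasDerivAt (fun s : ℝ => ‖ξ + s • η‖ ^ 2) (2 * inner ℝ (ξ + s • η) η) s := by
    simpa using hl.norm_sq
  have hn : HasDerivAt (fun s : ℝ => ‖ξ + s • η‖) (inner ℝ (ξ + s • η) η / ‖ξ + s • η‖) s := by
    have hpos : 0 < ‖ξ + s • η‖ := norm_pos_iff.2 h0
    have := hsq.sqrt (by positivity)
    simp only [Real.sqrt_sq (norm_nonneg _)] at this
    convert this using 1
    field_simp
  have := ((ha.hasDerivAt.comp s hn).smul hl).inner ℝ (hasDerivAt_const s c)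
  refine this.congr_deriv ?_
  simp only [fluxForm, inner_add_left, inner_smul_left, inner_zero_right, RCLike.conj_to_real,
    Function.comp]
  ring

/-- Mean value form of the Picone inequality for the increment of the flux. -/
theorem exists_inner_flux_sub_le {a : ℝ → ℝ} (ha : ContDiffOn ℝ 1 a (Ioi 0))
    (ha_pos : ∀ t : ℝ, 0 < t → 0 < a t)
    (ha_ell : ∀ t : ℝ, 0 < t → 0 < a t + deriv a t * t) {ξ ξ' : F}
    (h0 : ∀ ζ ∈ segment ℝ ξ ξ', ζ ≠ 0) (t : ℝ) (q : F) (r : ℝ) :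
    ∃ ζ ∈ segment ℝ ξ ξ',
      t⁻¹ * inner ℝ (a ‖ξ'‖ • ξ' - a ‖ξ‖ • ξ) ((2 * r) • q - r ^ 2 • t⁻¹ • (ξ' - ξ)) ≤
        fluxForm a ζ q q := by
  have hmem : ∀ s ∈ Icc (0 : ℝ) 1, ξ + s • (ξ' - ξ) ∈ segment ℝ ξ ξ' := fun s hs => by
    rw [segment_eq_image']; exact ⟨s, hs, rfl⟩
  set c := (2 * r) • q - r ^ 2 • t⁻¹ • (ξ' - ξ) with hc
  have hd : ∀ s ∈ Icc (0 : ℝ) 1, HasDerivAt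
      (fun s : ℝ => inner ℝ (a ‖ξ + s • (ξ' - ξ)‖ • (ξ + s • (ξ' - ξ))) c)
      (fluxForm a (ξ + s • (ξ' - ξ)) (ξ' - ξ) c) s := fun s hs => by
    have hne := h0 _ (hmem s hs)
    refine hasDerivAt_inner_flux_segment hne ?_ c
    exact (ha.differentiableOn one_ne_zero).differentiableAt
      (Ioi_mem_nhds (norm_pos_iff.2 hne))
  -- The flux is paired with the fixed vector `c`, so the scalar mean value theorem applies.
  obtain ⟨s, hs, hval⟩ := exists_hasDerivAt_eq_slope _ _ (zero_lt_one' ℝ)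
    (fun s hs => (hd s hs).continuousAt.continuousWithinAt)
    (fun s hs => hd s (Ioo_subset_Icc_self hs))
  have hs' := hmem s (Ioo_subset_Icc_self hs)
  refine ⟨_, hs', ?_⟩
  have hp := fluxForm_picone ha_pos ha_ell (h0 _ hs') (t⁻¹ • (ξ' - ξ)) q r
  refine le_trans (le_of_eq ?_) hp
  rw [← hc]
  have hh : ∀ ζ : F, fluxForm a ζ (t⁻¹ • (ξ' - ξ)) c = t⁻¹ * fluxForm a ζ (ξ' - ξ) c := by
    intro ζ
    simp only [fluxForm, inner_smul_left, inner_smul_right, RCLike.conj_to_real]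
    ring
  rw [hh, hval]
  simp [inner_sub_left]

theorem continuousAt_fluxForm {a : ℝ → ℝ} (ha : ContDiffOn ℝ 1 a (Ioi 0)) {ξ : F}
    (hξ : ξ ≠ 0) (q : F) :
    ContinuousAt (fun p : F × F => fluxForm a p.1 p.2 p.2) (ξ, q) := by
  have hr : 0 < ‖ξ‖ := norm_pos_iff.2 hξ
  have h1 : ContinuousAt (fun p : F × F => a ‖p.1‖) (ξ, q) :=
    ContinuousAt.comp (f := fun p : F × F => ‖p.1‖) (x := (ξ, q))
      (ha.continuousOn.continuousAt (Ioi_mem_nhds hr)) (by fun_prop)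
  have h2 : ContinuousAt (fun p : F × F => deriv a ‖p.1‖) (ξ, q) :=
    ContinuousAt.comp (f := fun p : F × F => ‖p.1‖) (x := (ξ, q))
      ((ha.continuousOn_deriv_of_isOpen isOpen_Ioi le_rfl).continuousAt (Ioi_mem_nhds hr))
      (by fun_prop)
  have h3 : ContinuousAt (fun p : F × F => ‖p.1‖) (ξ, q) := by fun_prop
  have h4 : ContinuousAt (fun p : F × F => inner ℝ p.1 p.2) (ξ, q) := by fun_prop
  have h5 : ContinuousAt (fun p : F × F => inner ℝ p.2 p.2) (ξ, q) := by fun_prop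
  exact (((h2.div h3 hr.ne').mul h4).mul h4).add (h1.mul h5)

end Flux

/-! ### Difference quotients, jointly in the step and the base point -/

section DifferenceQuotient

variable {E F : Type*} [NormedAddCommGroup E] [NormedSpace ℝ E] [NormedAddCommGroup F]
  [NormedSpace ℝ F]

theorem tendsto_shift (x e : E) :
    Tendsto (fun z : ℝ × E => z.2 + z.1 • e) (𝓝 (0, x)) (𝓝 x) := by
  have : Continuous (fun z : ℝ × E => z.2 + z.1 • e) := by fun_prop
  simpa using this.tendsto (0, x)

/-- Difference quotients of a strictly differentiable function converge locally uniformly. -/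
theorem HasStrictFDerivAt.tendsto_diffQuot {g : E → F} {g' : E →L[ℝ] F} {x : E}
    (hg : HasStrictFDerivAt g g' x) (e : E) :
    Tendsto (fun z : ℝ × E => z.1⁻¹ • (g (z.2 + z.1 • e) - g z.2))
      (𝓝[{z | 0 < z.1}] (0, x)) (𝓝 (g' e)) := by
  have h1 : Tendsto (fun z : ℝ × E => (z.2 + z.1 • e, z.2)) (𝓝[{z | 0 < z.1}] (0, x))
      (𝓝 (x, x)) :=
    ((tendsto_shift x e).prodMk_nhds continuous_snd.continuousAt).mono_left nhdsWithin_le_nhds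
  have h2 := hg.isLittleO.comp_tendsto h1
  have h3 : (fun z : ℝ × E => z.1 • e) =O[𝓝[{z | 0 < z.1}] (0, x)] fun z => z.1 :=
    Asymptotics.IsBigO.of_bound ‖e‖ (Eventually.of_forall fun z => by
      rw [norm_smul, mul_comm])
  have h4 := (h2.trans_isBigO (h3.congr_left fun z => by simp)).tendsto_inv_smul_nhds_zero
  have h5 := h4.add_const (g' e)
  rw [zero_add] at h5
  refine h5.congr' ?_
  filter_upwards [self_mem_nhdsWithin] with z hz
  have hz' : z.1 ≠ 0 := ne_of_gt hz
  simp [smul_sub, smul_smul, inv_mul_cancel₀ hz']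

theorem diffQuot_pos {u : E → ℝ} (hu : ContDiff ℝ 1 u) {e : E}
    (he : ∀ x, 0 < fderiv ℝ u x e) (x : E) {t : ℝ} (ht : 0 < t) :
    0 < t⁻¹ * (u (x + t • e) - u x) := by
  have hd : ∀ s : ℝ, HasDerivAt (fun s : ℝ => u (x + s • e)) (fderiv ℝ u (x + s • e) e) s := by
    intro s
    have hl : HasDerivAt (fun s : ℝ => x + s • e) e s := by
      simpa using ((hasDerivAt_id s).smul_const e).const_add x
    exact ((hu.differentiable one_ne_zero) _).hasFDerivAt.comp_hasDerivAt s hl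
  have hm : StrictMono (fun s : ℝ => u (x + s • e)) :=
    strictMono_of_hasDerivAt_pos hd fun s => he _
  have := hm ht
  simp only [zero_smul, add_zero] at this
  have : 0 < u (x + t • e) - u x := sub_pos.2 this
  positivity

end DifferenceQuotient

/-! ### Weighted integrals, the coefficient matrix and gradients -/

theorem integral_weightedMeasure {n : ℕ} {G : EuclideanSpace ℝ (Fin n) → ℝ} (hG : Continuous G)
    (g : EuclideanSpace ℝ (Fin n) → ℝ) :
    ∫ x, g x ∂(weightedMeasure G) = ∫ x, Real.exp (G x) * g x := by
  unfold weightedMeasure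
  rw [integral_withDensity_eq_integral_toReal_smul (by fun_prop) (by simp)]
  simp [ENNReal.toReal_ofReal (Real.exp_pos _).le]

theorem inner_toEuclideanLin_coeffMatrix {n : ℕ} (a : ℝ → ℝ) (ξ η : EuclideanSpace ℝ (Fin n)) :
    inner ℝ (Matrix.toEuclideanLin (coeffMatrix a ξ) η) η = fluxForm a ξ η η := by
  have h : Matrix.toEuclideanLin (coeffMatrix a ξ) η =
      (deriv a ‖ξ‖ / ‖ξ‖ * inner ℝ ξ η) • ξ + a ‖ξ‖ • η := by
    ext k
    simp only [Matrix.toLpLin_apply, Matrix.mulVec, dotProduct, coeffMatrix, Matrix.of_apply,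
      add_mul, Finset.sum_add_distrib, PiLp.add_apply, PiLp.smul_apply, smul_eq_mul,
      PiLp.inner_apply, RCLike.inner_apply, RCLike.conj_to_real]
    congr 1
    · rw [Finset.mul_sum, Finset.sum_mul]
      exact Finset.sum_congr rfl fun j _ => by ring
    · simp [Matrix.one_apply]
  rw [h, inner_add_left, inner_smul_left, inner_smul_left]
  simp [fluxForm]

section

variable {E : Type*} [NormedAddCommGroup E] [InnerProductSpace ℝ E] [CompleteSpace E]

theorem continuous_gradient_of_contDiff {u : E → ℝ} (hu : ContDiff ℝ 1 u) :
    Continuous (gradient u) :=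
  (InnerProductSpace.toDual ℝ E).symm.continuous.comp (hu.continuous_fderiv one_ne_zero)

theorem continuous_flux {a : ℝ → ℝ} (ha : ContinuousOn a (Ioi 0)) {u : E → ℝ}
    (hu : ContDiff ℝ 1 u) (h0 : ∀ x, gradient u x ≠ 0) :
    Continuous fun x => a ‖gradient u x‖ • gradient u x :=
  (ha.comp_continuous (continuous_gradient_of_contDiff hu).norm fun x => norm_pos_iff.2 (h0 x)).smul
    (continuous_gradient_of_contDiff hu)

/-- Symmetry of the second derivative: it identifies the numerator of `h` with the limit of the
difference quotient of `∇G` in direction `e`. -/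
theorem inner_gradient_partial_eq {G : E → ℝ} (hG : ContDiff ℝ 2 G) (e v x : E) :
    inner ℝ v (gradient (fun y => fderiv ℝ G y e) x) = fderiv ℝ (fderiv ℝ G) x e v := by
  have hd : DifferentiableAt ℝ (fderiv ℝ G) x :=
    ((hG.fderiv_right (m := 1) (by norm_num)).differentiable one_ne_zero) x
  have hs : IsSymmSndFDerivAt ℝ G x := hG.contDiffAt.isSymmSndFDerivAt (by simp)
  rw [inner_gradient_right, hs.eq e v]
  rw [fderiv_clm_apply hd (differentiableAt_const e)]
  simp

end

theorem fderiv_eq_zero_of_notMem_tsupport {E F : Type*} [NormedAddCommGroup E]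
    [NormedSpace ℝ E] [NormedAddCommGroup F] [NormedSpace ℝ F] {g : E → F} {x : E}
    (hx : x ∉ tsupport g) : fderiv ℝ g x = 0 := by
  by_contra h
  exact hx (support_fderiv_subset ℝ h)

/-! ### Translating and differencing the weak equation -/

/-- The weak equation, translated by `v` and rewritten with the weight at the base point. -/
theorem IsWeakSolution.integral_translate {n : ℕ} {a f : ℝ → ℝ}
    {G u : EuclideanSpace ℝ (Fin n) → ℝ}
    (hu : IsWeakSolution a f G u) (hG : ContDiff ℝ 1 G) {Φ : EuclideanSpace ℝ (Fin n) → ℝ}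
    (hΦ : ContDiff ℝ 1 Φ) (hc : HasCompactSupport Φ) (v : EuclideanSpace ℝ (Fin n)) :
    ∫ x, Real.exp (G x) *
      (fderiv ℝ Φ x (a ‖gradient u (x + v)‖ • gradient u (x + v))
        - (fderiv ℝ G (x + v) - fderiv ℝ G x) (a ‖gradient u (x + v)‖ • gradient u (x + v)) * Φ x
        - f (u (x + v)) * Φ x) = 0 := by
  -- The exponential factor turns the weight `e^{G(x+v)}` into `e^{G(x)}` after translation;
  -- differentiating it produces the `∇G` increment.
  set χ : EuclideanSpace ℝ (Fin n) → ℝ :=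
    fun y => Φ (y - v) * Real.exp (G (y - v) - G y) with hχ
  have hχ1 : ContDiff ℝ 1 χ := by
    have : ContDiff ℝ 1 fun y : EuclideanSpace ℝ (Fin n) => y - v := contDiff_id.sub contDiff_const
    exact (hΦ.comp this).mul (((hG.comp this).sub hG).exp)
  have hχc : HasCompactSupport χ := by
    have : HasCompactSupport fun y => Φ (y - v) :=
      hc.comp_homeomorph (Homeomorph.subRight v)
    exact this.mul_right
  have h := hu.weak_eq χ hχ1 hχc
  rw [integral_weightedMeasure hG.continuous, ← integral_add_right_eq_self _ v] at h
  rw [← h]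
  congr 1
  ext x
  have hdχ : ∀ w, fderiv ℝ χ (x + v) w =
      Real.exp (G x - G (x + v)) *
        (fderiv ℝ Φ x w + Φ x * (fderiv ℝ G x w - fderiv ℝ G (x + v) w)) := by
    intro w
    have hs : HasFDerivAt (fun y : EuclideanSpace ℝ (Fin n) => y - v)
        (ContinuousLinearMap.id ℝ _) (x + v) := (hasFDerivAt_id _).sub_const v
    have e1 : x + v - v = x := add_sub_cancel_right x v
    have hΦ' : HasFDerivAt Φ (fderiv ℝ Φ x) (x + v - v) := by
      rw [e1]; exact (hΦ.differentiable one_ne_zero x).hasFDerivAt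
    have hG' : HasFDerivAt G (fderiv ℝ G x) (x + v - v) := by
      rw [e1]; exact (hG.differentiable one_ne_zero x).hasFDerivAt
    have hGv := (hG.differentiable one_ne_zero (x + v)).hasFDerivAt
    have := (hΦ'.comp (x + v) hs).mul ((((hG'.comp (x + v) hs).sub hGv)).exp)
    have := this.fderiv
    simp only [Function.comp_def, Pi.sub_apply, e1, ContinuousLinearMap.comp_id] at this
    have h2 : fderiv ℝ χ (x + v) = _ := this
    rw [h2]
    simp
    ring
  rw [inner_gradient_right, RCLike.conj_to_real, hdχ]
  have he : Real.exp (G (x + v)) * Real.exp (G x - G (x + v)) = Real.exp (G x) := by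
    rw [← Real.exp_add]; congr 1; ring
  simp only [hχ, add_sub_cancel_right, sub_apply]
  rw [← he]
  ring

/-- The difference quotient of the weak equation in the direction `e`. -/
theorem IsWeakSolution.integral_diffQuot {n : ℕ} {a f : ℝ → ℝ}
    {G u : EuclideanSpace ℝ (Fin n) → ℝ}
    (hu : IsWeakSolution a f G u) (ha : ContinuousOn a (Ioi 0)) (hf : Continuous f)
    (hG : ContDiff ℝ 1 G) (h0 : ∀ x, gradient u x ≠ 0) {Φ : EuclideanSpace ℝ (Fin n) → ℝ}
    (hΦ : ContDiff ℝ 1 Φ) (hc : HasCompactSupport Φ) (e : EuclideanSpace ℝ (Fin n)) (t : ℝ) :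
    let V := fun x => a ‖gradient u x‖ • gradient u x
    Integrable (fun x => Real.exp (G x) *
      (t⁻¹ * fderiv ℝ Φ x (V (x + t • e) - V x)
        - (t⁻¹ • (fderiv ℝ G (x + t • e) - fderiv ℝ G x)) (V (x + t • e)) * Φ x
        - t⁻¹ * (f (u (x + t • e)) - f (u x)) * Φ x)) ∧
    ∫ x, Real.exp (G x) *
      (t⁻¹ * fderiv ℝ Φ x (V (x + t • e) - V x)
        - (t⁻¹ • (fderiv ℝ G (x + t • e) - fderiv ℝ G x)) (V (x + t • e)) * Φ x
        - t⁻¹ * (f (u (x + t • e)) - f (u x)) * Φ x) = 0 := by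
  intro V
  have hV : Continuous V := continuous_flux ha hu.contDiff h0
  have hint : ∀ v : EuclideanSpace ℝ (Fin n), Integrable (fun x => Real.exp (G x) *
      (fderiv ℝ Φ x (V (x + v))
        - (fderiv ℝ G (x + v) - fderiv ℝ G x) (V (x + v)) * Φ x
        - f (u (x + v)) * Φ x)) := by
    intro v
    have hs : Continuous fun x : EuclideanSpace ℝ (Fin n) => x + v := continuous_add_const v
    have hdΦ := hΦ.continuous_fderiv one_ne_zero
    have hdG := hG.continuous_fderiv one_ne_zero
    refine Continuous.integrable_of_hasCompactSupport ?_ ?_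
    · exact (Real.continuous_exp.comp hG.continuous).mul
        (((hdΦ.clm_apply (hV.comp hs)).sub
          ((((hdG.comp hs).sub hdG).clm_apply (hV.comp hs)).mul hΦ.continuous)).sub
          ((hf.comp (hu.contDiff.continuous.comp hs)).mul hΦ.continuous))
    · refine HasCompactSupport.intro hc fun x hx => ?_
      simp [fderiv_eq_zero_of_notMem_tsupport hx, image_eq_zero_of_notMem_tsupport hx]
  have hz := hu.integral_translate hG hΦ hc 0
  have ht := hu.integral_translate hG hΦ hc (t • e)
  have hd := ((hint (t • e)).sub (hint 0)).const_mul t⁻¹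
  have hi : ∫ x, t⁻¹ * (Real.exp (G x) *
      (fderiv ℝ Φ x (V (x + t • e))
        - (fderiv ℝ G (x + t • e) - fderiv ℝ G x) (V (x + t • e)) * Φ x
        - f (u (x + t • e)) * Φ x) - Real.exp (G x) *
      (fderiv ℝ Φ x (V (x + 0))
        - (fderiv ℝ G (x + 0) - fderiv ℝ G x) (V (x + 0)) * Φ x
        - f (u (x + 0)) * Φ x)) = 0 := by
    rw [integral_const_mul, integral_sub (hint _) (hint 0), ht, hz]
    simp
  have hfun : (fun x => Real.exp (G x) *
      (t⁻¹ * fderiv ℝ Φ x (V (x + t • e) - V x)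
        - (t⁻¹ • (fderiv ℝ G (x + t • e) - fderiv ℝ G x)) (V (x + t • e)) * Φ x
        - t⁻¹ * (f (u (x + t • e)) - f (u x)) * Φ x)) = fun x => t⁻¹ * (Real.exp (G x) *
      (fderiv ℝ Φ x (V (x + t • e))
        - (fderiv ℝ G (x + t • e) - fderiv ℝ G x) (V (x + t • e)) * Φ x
        - f (u (x + t • e)) * Φ x) - Real.exp (G x) *
      (fderiv ℝ Φ x (V (x + 0))
        - (fderiv ℝ G (x + 0) - fderiv ℝ G x) (V (x + 0)) * Φ x
        - f (u (x + 0)) * Φ x)) := by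
    ext x
    simp only [add_zero, sub_self, map_sub, zero_apply,
      smul_apply, sub_apply, smul_eq_mul]
    ring
  rw [hfun]
  exact ⟨hd, hi⟩

/-! ### Local comparison with the stability integrand -/

/-- Balls are convex, so the whole segment is near `ξ₀` once its endpoints are. This controls the
unknown mean value point. -/
theorem eventually_fluxForm_segment_lt {a : ℝ → ℝ} (ha : ContDiffOn ℝ 1 a (Ioi 0))
    {E X : Type*} [NormedAddCommGroup E] [InnerProductSpace ℝ E]
    {l : Filter X} {ξ ξ' q : X → E} {ξ₀ q₀ : E} (hξ₀ : ξ₀ ≠ 0)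
    (hξ : Tendsto ξ l (𝓝 ξ₀)) (hξ' : Tendsto ξ' l (𝓝 ξ₀)) (hq : Tendsto q l (𝓝 q₀))
    {c : ℝ} (hc : fluxForm a ξ₀ q₀ q₀ < c) :
    ∀ᶠ z in l, ∀ ζ ∈ segment ℝ (ξ z) (ξ' z), fluxForm a ζ (q z) (q z) < c := by
  have h := (continuousAt_fluxForm ha hξ₀ q₀).eventually (gt_mem_nhds hc)
  rw [nhds_prod_eq, eventually_prod_iff] at h
  obtain ⟨p, hp, p', hp', hpp⟩ := h
  obtain ⟨δ, hδ, hball⟩ := Metric.eventually_nhds_iff_ball.1 hp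
  filter_upwards [hξ (Metric.ball_mem_nhds ξ₀ hδ), hξ' (Metric.ball_mem_nhds ξ₀ hδ),
    hq.eventually hp'] with z h1 h2 h3 ζ hζ
  exact hpp (hball _ ((convex_ball ξ₀ δ).segment_subset h1 h2 hζ)) h3

section

variable {E : Type*} [NormedAddCommGroup E] [InnerProductSpace ℝ E] [CompleteSpace E]

/-- The half-space of vectors with positive inner product with `e` is convex and omits `0`. -/
theorem ne_zero_of_mem_segment_gradient {u : E → ℝ} {e x y : E}
    (hx : 0 < fderiv ℝ u x e) (hy : 0 < fderiv ℝ u y e) {ζ : E}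
    (hζ : ζ ∈ segment ℝ (gradient u x) (gradient u y)) : ζ ≠ 0 := by
  rintro rfl
  obtain ⟨α, β, hα, hβ, hαβ, h⟩ := hζ
  have h' := congrArg (fun v => inner ℝ v e) h
  simp only [inner_add_left, inner_smul_left, inner_gradient_left, RCLike.conj_to_real,
    inner_zero_left] at h'
  rcases hα.eq_or_lt with rfl | hα
  · obtain rfl : β = 1 := by linarith
    linarith
  · have := mul_pos hα hx
    have := mul_nonneg hβ hy.le
    linarith

/-- The quotient rule, arranged in the Picone shape with `q = ∇φ` and `r = φ / wₜ`. -/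
theorem fderiv_sq_div_diffQuot {u φ : E → ℝ} (hu : ContDiff ℝ 1 u) (hφ : ContDiff ℝ 1 φ)
    {e x : E} {t : ℝ} (hw : t⁻¹ * (u (x + t • e) - u x) ≠ 0) (v : E) :
    fderiv ℝ (fun y => φ y ^ 2 / (t⁻¹ * (u (y + t • e) - u y))) x v =
      inner ℝ v ((2 * (φ x / (t⁻¹ * (u (x + t • e) - u x)))) • gradient φ x -
        (φ x / (t⁻¹ * (u (x + t • e) - u x))) ^ 2 • t⁻¹ •
          (gradient u (x + t • e) - gradient u x)) := by
  have hs : HasFDerivAt (fun y : E => y + t • e) (ContinuousLinearMap.id ℝ _) x :=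
    (hasFDerivAt_id _).add_const (t • e)
  have hu0 := (hu.differentiable one_ne_zero x).hasFDerivAt
  have hu1 := (hu.differentiable one_ne_zero (x + t • e)).hasFDerivAt
  have hφ0 := (hφ.differentiable one_ne_zero x).hasFDerivAt
  have hd := (hφ0.pow 2).mul
    ((hasDerivAt_inv hw).comp_hasFDerivAt x (((hu1.comp x hs).sub hu0).const_mul t⁻¹))
  have h2 : fderiv ℝ (fun y => φ y ^ 2 / (t⁻¹ * (u (y + t • e) - u y))) x = _ := hd.fderiv
  rw [h2]
  simp only [inner_sub_right, inner_smul_right, inner_gradient_right, RCLike.conj_to_real,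
    add_apply, smul_apply, sub_apply, ContinuousLinearMap.comp_apply,
    ContinuousLinearMap.id_apply, smul_eq_mul, Function.comp, Pi.sub_apply]
  generalize t⁻¹ * (u (x + t • e) - u x) = w at hw ⊢
  simp
  field_simp
  ring

/-- The integrand of the difference quotient of the weak equation, tested with `φ² / wₜ` where
`wₜ` is the difference quotient of `u`, is locally uniformly almost bounded by the integrand of
the stability inequality. -/
theorem eventually_diffQuot_integrand_le {a f : ℝ → ℝ} {G u φ : E → ℝ}
    (ha : ContDiffOn ℝ 1 a (Ioi 0)) (ha_pos : ∀ t : ℝ, 0 < t → 0 < a t)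
    (ha_ell : ∀ t : ℝ, 0 < t → 0 < a t + deriv a t * t) (hf : ContDiff ℝ 1 f)
    (hG : ContDiff ℝ 2 G) (hu : ContDiff ℝ 1 u) (hφ : ContDiff ℝ 1 φ) {e : E}
    (he : ∀ x, 0 < fderiv ℝ u x e) {Q : E → ℝ} (hQ : Continuous Q)
    (hQ_eq : ∀ x, Q x = fluxForm a (gradient u x) (gradient φ x) (gradient φ x)
      - deriv f (u x) * φ x ^ 2 - a ‖gradient u x‖ *
        (inner ℝ (gradient u x) (gradient (fun y => fderiv ℝ G y e) x) / fderiv ℝ u x e) *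
          φ x ^ 2) {ε : ℝ} (hε : 0 < ε) (x₀ : E) :
    let V := fun x => a ‖gradient u x‖ • gradient u x
    let Φ := fun (t : ℝ) x => φ x ^ 2 / (t⁻¹ * (u (x + t • e) - u x))
    ∀ᶠ z : ℝ × E in 𝓝[{z | 0 < z.1}] (0, x₀),
      z.1⁻¹ * fderiv ℝ (Φ z.1) z.2 (V (z.2 + z.1 • e) - V z.2)
        - (z.1⁻¹ • (fderiv ℝ G (z.2 + z.1 • e) - fderiv ℝ G z.2)) (V (z.2 + z.1 • e)) * Φ z.1 z.2
        - z.1⁻¹ * (f (u (z.2 + z.1 • e)) - f (u z.2)) * Φ z.1 z.2 ≤ Q z.2 + ε := by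
  intro V Φ
  set l := 𝓝[{z : ℝ × E | 0 < z.1}] ((0 : ℝ), x₀)
  have h0 : ∀ x, gradient u x ≠ 0 := fun x =>
    ne_zero_of_mem_segment_gradient (he x) (he x) (left_mem_segment ℝ _ _)
  have hV : Continuous V := continuous_flux ha.continuousOn hu h0
  have ht1 : Tendsto (fun z : ℝ × E => z.2 + z.1 • e) l (𝓝 x₀) :=
    (tendsto_shift x₀ e).mono_left nhdsWithin_le_nhds
  have ht2 : Tendsto (fun z : ℝ × E => z.2) l (𝓝 x₀) :=
    (continuous_snd.tendsto (0, x₀)).mono_left nhdsWithin_le_nhds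
  have hgu := continuous_gradient_of_contDiff hu
  have hgφ := continuous_gradient_of_contDiff hφ
  have hw : Tendsto (fun z : ℝ × E => z.1⁻¹ * (u (z.2 + z.1 • e) - u z.2)) l
      (𝓝 (fderiv ℝ u x₀ e)) :=
    (hu.contDiffAt.hasStrictFDerivAt one_ne_zero).tendsto_diffQuot e
  have hfu : Tendsto (fun z : ℝ × E => z.1⁻¹ * (f (u (z.2 + z.1 • e)) - f (u z.2))) l
      (𝓝 (deriv f (u x₀) * fderiv ℝ u x₀ e)) := by
    have h := ((hf.contDiffAt.hasStrictDerivAt one_ne_zero).comp_hasStrictFDerivAt x₀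
      (hu.contDiffAt.hasStrictFDerivAt one_ne_zero)).tendsto_diffQuot e
    exact h
  have hdG : Tendsto (fun z : ℝ × E =>
      z.1⁻¹ • (fderiv ℝ G (z.2 + z.1 • e) - fderiv ℝ G z.2)) l
      (𝓝 (fderiv ℝ (fderiv ℝ G) x₀ e)) :=
    ((hG.fderiv_right (m := 1) (by norm_num)).contDiffAt.hasStrictFDerivAt
      one_ne_zero).tendsto_diffQuot e
  have hΦ : Tendsto (fun z : ℝ × E => Φ z.1 z.2) l (𝓝 (φ x₀ ^ 2 / fderiv ℝ u x₀ e)) :=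
    (((hφ.continuous.tendsto x₀).comp ht2).pow 2).div hw (he x₀).ne'
  have hdGV : Tendsto (fun z : ℝ × E =>
      (z.1⁻¹ • (fderiv ℝ G (z.2 + z.1 • e) - fderiv ℝ G z.2)) (V (z.2 + z.1 • e))) l
      (𝓝 (fderiv ℝ (fderiv ℝ G) x₀ e (V x₀))) :=
    (isBoundedBilinearMap_apply.continuous.tendsto (fderiv ℝ (fderiv ℝ G) x₀ e, V x₀)).comp
      (hdG.prodMk_nhds ((hV.tendsto x₀).comp ht1))
  have hR := (hdGV.mul hΦ).add (hfu.mul hΦ)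
  -- The factor `∂ₑu` cancels in the `f'` term and survives as the denominator of `h` in the `G`
  -- term.
  have hQ0 : Q x₀ = fluxForm a (gradient u x₀) (gradient φ x₀) (gradient φ x₀) -
      (fderiv ℝ (fderiv ℝ G) x₀ e (V x₀) * (φ x₀ ^ 2 / fderiv ℝ u x₀ e) +
        deriv f (u x₀) * fderiv ℝ u x₀ e * (φ x₀ ^ 2 / fderiv ℝ u x₀ e)) := by
    rw [hQ_eq, inner_gradient_partial_eq hG]
    have := (he x₀).ne'
    simp only [V, map_smul, smul_eq_mul]
    field_simp
    ring
  -- One third each for the flux form, the lower-order terms and the continuity of `Q`.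
  have hε3 : 0 < ε / 3 := by positivity
  filter_upwards [self_mem_nhdsWithin,
    eventually_fluxForm_segment_lt ha (h0 x₀) ((hgu.tendsto x₀).comp ht2)
      ((hgu.tendsto x₀).comp ht1) ((hgφ.tendsto x₀).comp ht2) (lt_add_of_pos_right _ hε3),
    hR.eventually (lt_mem_nhds (sub_lt_self _ hε3)),
    ((hQ.tendsto x₀).comp ht2).eventually (lt_mem_nhds (sub_lt_self _ hε3))] with z hz h1 h2 h3
  obtain ⟨t, y⟩ := z
  have ht : 0 < t := hz
  simp only [Function.comp] at h1 h2 h3 ⊢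
  have hwpos := diffQuot_pos hu he y ht
  obtain ⟨ζ, hζ, hle⟩ := exists_inner_flux_sub_le ha ha_pos ha_ell
    (fun ζ => ne_zero_of_mem_segment_gradient (u := u) (he y) (he (y + t • e)))
    t (gradient φ y) (φ y / (t⁻¹ * (u (y + t • e) - u y)))
  have hlt := h1 ζ hζ
  rw [← fderiv_sq_div_diffQuot hu hφ hwpos.ne'] at hle
  change t⁻¹ * fderiv ℝ (Φ t) y (V (y + t • e) - V y) ≤ _ at hle
  linarith

end

/-! ### Integration and conclusion -/

theorem IsWeakSolution.stability_integral_nonneg {n : ℕ} {a f : ℝ → ℝ}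
    {G u φ Q : EuclideanSpace ℝ (Fin n) → ℝ} (hsol : IsWeakSolution a f G u)
    (ha : ContDiffOn ℝ 1 a (Ioi 0)) (ha_pos : ∀ t : ℝ, 0 < t → 0 < a t)
    (ha_ell : ∀ t : ℝ, 0 < t → 0 < a t + deriv a t * t) (hf : ContDiff ℝ 1 f)
    (hG : ContDiff ℝ 2 G) (hφ : ContDiff ℝ 1 φ) (hc : HasCompactSupport φ)
    {e : EuclideanSpace ℝ (Fin n)} (he : ∀ x, 0 < fderiv ℝ u x e) (hQ : Continuous Q)
    (hQ_eq : ∀ x, Q x = fluxForm a (gradient u x) (gradient φ x) (gradient φ x)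
      - deriv f (u x) * φ x ^ 2 - a ‖gradient u x‖ *
        (inner ℝ (gradient u x) (gradient (fun y => fderiv ℝ G y e) x) / fderiv ℝ u x e) *
          φ x ^ 2) :
    0 ≤ ∫ x, Real.exp (G x) * Q x := by
  have hu := hsol.contDiff
  have h0 : ∀ x, gradient u x ≠ 0 := fun x =>
    ne_zero_of_mem_segment_gradient (he x) (he x) (left_mem_segment ℝ _ _)
  set K := tsupport φ
  have hKc : IsCompact K := hc
  have hexp : Continuous fun x => Real.exp (G x) := Real.continuous_exp.comp hG.continuous
  have hKm : MeasurableSet K := (isClosed_tsupport φ).measurableSet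
  set M := ∫ x in K, Real.exp (G x) with hM
  have hM0 : 0 ≤ M := integral_nonneg fun x => (Real.exp_pos _).le
  have hQK : ∫ x in K, Real.exp (G x) * Q x = ∫ x, Real.exp (G x) * Q x := by
    refine setIntegral_eq_integral_of_forall_compl_eq_zero fun x hx => ?_
    rw [hQ_eq, image_eq_zero_of_notMem_tsupport hx]
    simp [fluxForm, gradient, fderiv_eq_zero_of_notMem_tsupport hx]
  have key : ∀ ε > 0, 0 ≤ (∫ x, Real.exp (G x) * Q x) + ε * M := by
    intro ε hε
    set V := fun x => a ‖gradient u x‖ • gradient u x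
    -- Compactness of `K` makes one small `t` work at every point of `K`.
    have hunif := hKc.eventually_forall_of_forall_eventually
      (P := fun t y => 0 < t →
        t⁻¹ * fderiv ℝ (fun x => φ x ^ 2 / (t⁻¹ * (u (x + t • e) - u x))) y (V (y + t • e) - V y)
          - (t⁻¹ • (fderiv ℝ G (y + t • e) - fderiv ℝ G y)) (V (y + t • e)) *
            (φ y ^ 2 / (t⁻¹ * (u (y + t • e) - u y)))
          - t⁻¹ * (f (u (y + t • e)) - f (u y)) * (φ y ^ 2 / (t⁻¹ * (u (y + t • e) - u y))) ≤
            Q y + ε)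
      fun x₀ _ => eventually_nhdsWithin_iff.1
        (eventually_diffQuot_integrand_le ha ha_pos ha_ell hf hG hu hφ he hQ hQ_eq hε x₀)
    have hunif' := (hunif.filter_mono (nhdsWithin_le_nhds (s := Ioi (0 : ℝ)))).and
      self_mem_nhdsWithin
    obtain ⟨t, hle, ht⟩ := hunif'.exists
    have ht : 0 < t := ht
    set Φ := fun x => φ x ^ 2 / (t⁻¹ * (u (x + t • e) - u x)) with hΦ
    have hΦ1 : ContDiff ℝ 1 Φ :=
      (hφ.pow 2).div (contDiff_const.mul ((hu.comp (contDiff_id.add contDiff_const)).sub hu))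
        fun x => (diffQuot_pos hu he x ht).ne'
    have hΦc : HasCompactSupport Φ := by
      refine HasCompactSupport.intro hc fun x hx => ?_
      simp [hΦ, image_eq_zero_of_notMem_tsupport hx]
    have hΦK : tsupport Φ ⊆ K := by
      refine closure_mono fun x hx => ?_
      rw [Function.mem_support] at hx ⊢
      contrapose! hx
      simp [hΦ, hx]
    obtain ⟨hint, hzero⟩ := hsol.integral_diffQuot ha.continuousOn hf.continuous
      (hG.of_le (by norm_num)) h0 hΦ1 hΦc e t
    rw [← setIntegral_eq_integral_of_forall_compl_eq_zero (s := K)] at hzero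
    · rw [← hQK, ← hzero, hM, ← integral_const_mul, ← integral_add]
      · refine setIntegral_mono_on hint.integrableOn ?_ hKm fun x hx => ?_
        · exact ((hexp.mul hQ).add (continuous_const.mul hexp)).continuousOn.integrableOn_compact
            hKc
        · have := mul_le_mul_of_nonneg_left (hle x hx ht) (Real.exp_pos (G x)).le
          refine this.trans (le_of_eq ?_)
          ring
      · exact (hexp.mul hQ).continuousOn.integrableOn_compact hKc
      · exact (continuous_const.mul hexp).continuousOn.integrableOn_compact hKc
    · intro x hx
      have hx' : x ∉ tsupport Φ := fun h => hx (hΦK h)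
      rw [fderiv_eq_zero_of_notMem_tsupport hx', image_eq_zero_of_notMem_tsupport hx']
      simp
  refine le_of_forall_pos_le_add fun δ hδ => ?_
  -- `M + 1` rather than `M`, since `M = 0` when `K` is empty.
  have h := key (δ / (M + 1)) (by positivity)
  have : δ / (M + 1) * M ≤ δ := by
    rw [div_mul_eq_mul_div, div_le_iff₀ (by positivity)]
    nlinarith
  linarith

theorem mainTheorem5 {n : ℕ} (a f : ℝ → ℝ) (G u : EuclideanSpace ℝ (Fin n) → ℝ)
    (ha : IsC11LocPos a)
    (ha_pos : ∀ t : ℝ, 0 < t → 0 < a t)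
    (ha_ell : ∀ t : ℝ, 0 < t → 0 < a t + deriv a t * t)
    (hf : ContDiff ℝ 1 f)
    (hG : ContDiff ℝ 2 G)
    (hu : IsWeakSolution a f G u)
    (i : Fin n)
    (hmono : ∀ x, 0 < partialDeriv i u x) :
    IsHStable a f G
      (fun x => inner ℝ (gradient u x) (gradient (partialDeriv i G) x) / partialDeriv i u x)
      u := by
  set h := fun x => inner ℝ (gradient u x) (gradient (partialDeriv i G) x) / partialDeriv i u x
  have hu1 := hu.contDiff
  have hgu := continuous_gradient_of_contDiff hu1
  have h0 : ∀ x, gradient u x ≠ 0 := fun x =>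
    ne_zero_of_mem_segment_gradient (hmono x) (hmono x) (left_mem_segment ℝ _ _)
  have hGi : ContDiff ℝ 1 (partialDeriv i G) :=
    (hG.fderiv_right (m := 1) (by norm_num)).clm_apply contDiff_const
  have hui : Continuous (partialDeriv i u) :=
    (hu1.continuous_fderiv one_ne_zero).clm_apply continuous_const
  have hcont : Continuous h :=
    (hgu.inner (continuous_gradient_of_contDiff hGi)).div hui fun x => (hmono x).ne'
  refine ⟨hcont.locallyIntegrable, hu, fun φ hφ hc => ?_⟩
  have hgφ := continuous_gradient_of_contDiff hφ
  have hexp : Continuous fun x => Real.exp (G x) := Real.continuous_exp.comp hG.continuous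
  have hau : Continuous fun x => a ‖gradient u x‖ :=
    ha.1.continuousOn.comp_continuous hgu.norm fun x => norm_pos_iff.2 (h0 x)
  have hB : Continuous fun x => fluxForm a (gradient u x) (gradient φ x) (gradient φ x) :=
    continuous_iff_continuousAt.2 fun x => ContinuousAt.comp
      (f := fun x => (gradient u x, gradient φ x)) (continuousAt_fluxForm ha.1 (h0 x) _)
      (hgu.prodMk hgφ).continuousAt
  have hleft : Continuous fun x => a ‖gradient u x‖ * h x * φ x ^ 2 :=
    (hau.mul hcont).mul (hφ.continuous.pow 2)
  have hright : Continuous fun x =>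
      fluxForm a (gradient u x) (gradient φ x) (gradient φ x) - deriv f (u x) * φ x ^ 2 :=
    hB.sub (((hf.continuous_deriv le_rfl).comp hu1.continuous).mul (hφ.continuous.pow 2))
  have key := hu.stability_integral_nonneg ha.1 ha_pos ha_ell hf hG hφ hc hmono
    (hright.sub hleft) fun x => rfl
  simp only [inner_toEuclideanLin_coeffMatrix]
  rw [integral_weightedMeasure hG.continuous, integral_weightedMeasure hG.continuous]
  rw [← sub_nonneg, ← integral_sub]
  · simpa only [mul_sub, Pi.sub_apply] using key
  · refine (hexp.mul hright).integrable_of_hasCompactSupport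
      (HasCompactSupport.intro hc fun x hx => ?_)
    simp [image_eq_zero_of_notMem_tsupport hx, fluxForm, gradient,
      fderiv_eq_zero_of_notMem_tsupport hx]
  · refine (hexp.mul hleft).integrable_of_hasCompactSupport
      (HasCompactSupport.intro hc fun x hx => ?_)
    simp [image_eq_zero_of_notMem_tsupport hx]
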